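/- Let $\mathsf E_-$ and $\mathsf E_+$ be disjoint sets, each finite or countably infinite, and let $\mathsf E=\mathsf E_-\cup\mathsf E_+$. Each edge $\mathsf e\in\mathsf E_-$ is a copy of $(-\infty,0)$ and each $\mathsf e\in\mathsf E_+$ a copy of $(0,\infty)$. Let $(\alpha_{\mathsf e})_{\mathsf e\in\mathsf E}$ and $(\beta_{\mathsf e})_{\mathsf e\in\mathsf E}$ be families of real numbers with $\alpha_{\mathsf e}>0$ for all $\mathsf e\in\mathsf E$. On the complex Hilbert space $$L^2(\mathsf G)=\bigoplus_{\mathsf e\in\mathsf E_-}L^2(-\infty,0)\oplus\bigoplus_{\mathsf e\in\mathsf E_+}L^2(0,\infty)$$ (Hilbert direct sum) let $A_0$ be the operator whose domain is the algebraic direct sum $$D(A_0)=\bigoplus_{\mathsf e\in\mathsf E_-}C_c^\infty(-\infty,0)\oplus\bigoplus_{\mathsf e\in\mathsf E_+}C_c^\infty(0,\infty),\qquad A_0(u_{\mathsf e})_{\mathsf e}=\bigl(\alpha_{\mathsf e}u_{\mathsf e}'''+\beta_{\mathsf e}u_{\mathsf e}'\bigr)_{\mathsf e}.$$ Then $iA_0$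 is densely defined and symmetric, and its defect indices, i.e. the Hilbert space dimensions (as cardinals) of $\operatorname{ran}(iA_0-i)^\perp$ and $\operatorname{ran}(iA_0+i)^\perp$, in this order, are $$\bigl(2|\mathsf E_-|+|\mathsf E_+|,\ |\mathsf E_-|+2|\mathsf E_+|\bigr).$$ Accordingly, $A_0$ has a skew-self-adjoint extension on $L^2(\mathsf G)$ (a densely defined operator $B\supseteq A_0$ with $B^*=-B$) if and only if $2|\mathsf E_-|+|\mathsf E_+|=|\mathsf E_-|+2|\mathsf E_+|$. Unless exactly one of $\mathsf E_-$, $\mathsf E_+$ is infinite, this is the case if and only if $|\mathsf E_+|=|\mathsf E_-|$: for such graphs (in particular for all finite ones) $A_0$ has skew-self-adjoint extensions on $L^2(\mathsf G)$ if and only if $|\mathsf E_+|=|\mathsf E_-|$. -/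

import Mathlib

open MeasureTheory Set Cardinal
open scoped ContDiff DirectSum ENNReal LinearPMap

universe u

noncomputable section

namespace StarGraph

/-! ### Test functions on an open subset of the line -/

/-- `C_c^∞(Ω)`: complex-valued smooth functions with compact support contained in `Ω`, each one
being identified with its extension by zero to the whole line. -/
def TestFun (Ω : Set ℝ) : Submodule ℂ (ℝ → ℂ) where
  carrier := {φ | ContDiff ℝ ∞ φ ∧ HasCompactSupport φ ∧ tsupport φ ⊆ Ω}
  zero_mem' := by
    refine ⟨contDiff_const, HasCompactSupport.zero, ?_⟩
    simp [tsupport]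
  add_mem' := by
    rintro φ ψ ⟨h1, h2, h3⟩ ⟨k1, k2, k3⟩
    exact ⟨h1.add k1, h2.add k2, (tsupport_add φ ψ).trans (union_subset h3 k3)⟩
  smul_mem' := by
    rintro c φ ⟨h1, h2, h3⟩
    refine ⟨contDiff_const.smul h1, h2.smul_left (f := fun _ => c), ?_⟩
    exact (tsupport_smul_subset_right (fun _ => c) φ).trans h3

/-- The derivative `d/dx` on `C_c^∞(Ω)`. -/
def derivTest (Ω : Set ℝ) : TestFun Ω →ₗ[ℂ] TestFun Ω where
  toFun φ := ⟨deriv φ.1, by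
    obtain ⟨h1, h2, h3⟩ := φ.2
    exact ⟨(contDiff_infty_iff_deriv.1 h1).2, h2.deriv, tsupport_deriv_subset.trans h3⟩⟩
  map_add' φ ψ := by
    ext x
    have h1 : DifferentiableAt ℝ φ.1 x := (φ.2.1.differentiable (by simp)) x
    have h2 : DifferentiableAt ℝ ψ.1 x := (ψ.2.1.differentiable (by simp)) x
    exact deriv_add h1 h2
  map_smul' c φ := by
    ext x
    exact deriv_const_smul c ((φ.2.1.differentiable (by simp)) x)

/-- The Airy differential expression `α φ''' + β φ'` on `C_c^∞(Ω)`. -/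
def airyTest (Ω : Set ℝ) (a b : ℝ) : TestFun Ω →ₗ[ℂ] TestFun Ω :=
  (a : ℂ) • (derivTest Ω ∘ₗ derivTest Ω ∘ₗ derivTest Ω) + (b : ℂ) • derivTest Ω

theorem testFun_memLp {Ω : Set ℝ} (φ : TestFun Ω) :
    MemLp φ.1 2 (volume.restrict Ω) :=
  (φ.2.1.continuous.memLp_of_hasCompactSupport φ.2.2.1).restrict Ω

/-- The inclusion `C_c^∞(Ω) → L²(Ω)`. -/
def testToL2 (Ω : Set ℝ) : TestFun Ω →ₗ[ℂ] Lp ℂ 2 (volume.restrict Ω) where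
  toFun φ := (testFun_memLp φ).toLp φ.1
  map_add' φ ψ := MemLp.toLp_add (testFun_memLp φ) (testFun_memLp ψ)
  map_smul' c φ := MemLp.toLp_const_smul c (testFun_memLp φ)

theorem testToL2_injective {Ω : Set ℝ} (hΩ : IsOpen Ω) :
    Function.Injective (testToL2 Ω) := by
  intro φ ψ h
  have h' : φ.1 =ᵐ[volume.restrict Ω] ψ.1 := (MemLp.toLp_eq_toLp_iff (testFun_memLp φ) (testFun_memLp ψ)).1 h
  have hE : EqOn φ.1 ψ.1 Ω := Measure.eqOn_open_of_ae_eq h' hΩ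
    φ.2.1.continuous.continuousOn ψ.2.1.continuous.continuousOn
  ext x
  by_cases hx : x ∈ Ω
  · exact hE hx
  · rw [image_eq_zero_of_notMem_tsupport (fun h => hx (φ.2.2.2 h)),
      image_eq_zero_of_notMem_tsupport (fun h => hx (ψ.2.2.2 h))]

/-! ### The star graph, its `L²`-space and the minimal Airy operator

The edges in `Em` (the set `E_-`) are copies of `(-∞, 0)`, those in `Ep` (the set `E_+`) are
copies of `(0, ∞)`. -/

variable {Em Ep : Type u}

/-- The half-line parametrizing an edge. -/
def halfLine : Em ⊕ Ep → Set ℝ :=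
  Sum.elim (fun _ => Iio 0) (fun _ => Ioi 0)

theorem isOpen_halfLine (e : Em ⊕ Ep) : IsOpen (halfLine e) := by
  cases e
  · exact isOpen_Iio
  · exact isOpen_Ioi

variable (Em Ep) in
/-- `L²(G)`, the Hilbert space direct sum of the complex spaces `L²(e)` over all edges `e`. -/
abbrev L2G : Type u :=
  lp (fun e : Em ⊕ Ep => Lp ℂ 2 (volume.restrict (halfLine e))) 2

variable (Em Ep) in
/-- The (algebraic) direct sum of the spaces `C_c^∞(e)` over all edges `e`. -/
abbrev TestG : Type u :=
  ⨁ e : Em ⊕ Ep, TestFun (halfLine e)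

variable (Em Ep) in
/-- The inclusion of the direct sum of the `C_c^∞(e)` into `L²(G)`, edge by edge. -/
def toL2G : TestG Em Ep →ₗ[ℂ] L2G Em Ep where
  toFun φ := ⟨fun e => testToL2 (halfLine e) (φ e), by
    classical
    refine memℓp_gen (summable_of_hasFiniteSupport ((DFinsupp.finite_support φ).subset ?_))
    intro e he h0
    apply he
    simp [h0]⟩
  map_add' φ ψ := by
    ext1
    funext e
    exact map_add (testToL2 (halfLine e)) (φ e) (ψ e)
  map_smul' c φ := by
    ext1
    funext e
    exact map_smul (testToL2 (halfLine e)) c (φ e)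

theorem toL2G_injective : Function.Injective (toL2G Em Ep) := by
  intro φ ψ h
  refine DFinsupp.ext fun e => testToL2_injective (isOpen_halfLine e) ?_
  exact congrFun (congrArg (fun f : L2G Em Ep => (f : ∀ e, _)) h) e

/-- The Airy expression `(α_e φ_e''' + β_e φ_e')_e`, edge by edge. -/
def airyG (α β : Em ⊕ Ep → ℝ) : TestG Em Ep →ₗ[ℂ] TestG Em Ep :=
  DirectSum.lmap fun e => airyTest (halfLine e) (α e) (β e)

/-- The operator `A₀` in `L²(G)`: its domain is the direct sum of the `C_c^∞(e)`, and it maps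
`(φ_e)_e` to `(α_e φ_e''' + β_e φ_e')_e`. -/
def A₀ (α β : Em ⊕ Ep → ℝ) : L2G Em Ep →ₗ.[ℂ] L2G Em Ep where
  domain := LinearMap.range (toL2G Em Ep)
  toFun := toL2G Em Ep ∘ₗ airyG α β ∘ₗ
    (LinearEquiv.ofInjective (toL2G Em Ep) toL2G_injective).symm

/-! ### Operator-theoretic notions -/

variable {H : Type u} [NormedAddCommGroup H] [InnerProductSpace ℂ H]

/-- A densely defined operator is symmetric if `⟪T x, y⟫ = ⟪x, T y⟫` on its domain. -/
def IsSymmetricOp (T : H →ₗ.[ℂ] H) : Prop :=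
  T.IsFormalAdjoint T

/-- `B` is skew-self-adjoint: densely defined with `B* = -B`. -/
def IsSkewSelfAdjoint [CompleteSpace H] (B : H →ₗ.[ℂ] H) : Prop :=
  Dense (B.domain : Set H) ∧ B† = -B

variable (H) in
/-- The Hilbert dimension: the common cardinality of all Hilbert bases of `H`. -/
def hilbertDim : Cardinal.{u} :=
  sInf {κ | ∃ s : Set H, Nonempty (HilbertBasis s ℂ H) ∧ #s = κ}

/-- The defect subspace `(ran (T - z))^⊥` of `T` at the point `z`. -/
def defectSpace (T : H →ₗ.[ℂ] H) (z : ℂ) : Submodule ℂ H :=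
  (LinearMap.range (T.toFun - z • T.domain.subtype))ᗮ

/-- The defect indices `(dim (ran (T - i))^⊥, dim (ran (T + i))^⊥)`. -/
def defectIndices (T : H →ₗ.[ℂ] H) : Cardinal.{u} × Cardinal.{u} :=
  (hilbertDim (defectSpace T Complex.I), hilbertDim (defectSpace T (-Complex.I)))

end StarGraph

end

/-! ### Hilbert dimension -/

section HilbertDimension

variable {H K : Type u} [NormedAddCommGroup H] [InnerProductSpace ℂ H]
  [NormedAddCommGroup K] [InnerProductSpace ℂ K]

/-! Multiplication by `i` carries the defect spaces of `A₀` at `±1` to those of `i A₀` at `±i`.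
Since the domain is an algebraic direct sum, a family in `L²(G)` is orthogonal to the range of `A₀ ∓
1` iff this holds on every edge, so the dimensions add up over the edges. On one edge, `α d³ + β d -
s` with `s = ±1` factors into `α ∏ (d - λ_j)`, and the annihilator of its range is built from those
`e^{-λ_j x}` that are square integrable there. For `s = 1` one root is positive and two lie in the
left half-plane: one exponential decays on `(0, ∞)` and two on `(-∞, 0)`. For `s = -1` the roots
change sign and the counts are exchanged.

The edge count treats one factor `d - μ` at a time. A functional vanishing on its range is a
multiple of `φ ↦ ∫ e^{-μ x} φ` (`eq_laplaceTest_of_comp_shiftedDeriv_eq_zero`). If `e^{-μ x}` grows,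
translating `φ` shows that no nonzero multiple is bounded, so the factor contributes nothing; if it
decays, rank-nullity gives one extra dimension.

For extensions, skew-symmetry makes the Cayley transform `(A - 1) x ↦ (A + 1) x` isometric.
Skew-self-adjoint extensions correspond to unitary extensions of it, which exist iff the complements
of the two ranges have equal Hilbert dimension. -/

theorem HilbertBasis.exists_reindex {ι κ : Type*} [CompleteSpace H] (b : HilbertBasis ι ℂ H)
    (e : κ ≃ ι) : ∃ b' : HilbertBasis κ ℂ H, (b' : κ → H) = b ∘ e := by
  have hsp : ⊤ ≤ (Submodule.span ℂ (Set.range (b ∘ e))).topologicalClosure := by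
    rw [EquivLike.range_comp, b.dense_span]
  exact ⟨HilbertBasis.mk (b.orthonormal.comp e e.injective) hsp, HilbertBasis.coe_mk _ _⟩

theorem HilbertBasis.orthonormal_injective {ι : Type*} (b : HilbertBasis ι ℂ H) :
    Function.Injective b :=
  b.orthonormal.linearIndependent.injective

namespace StarGraph

theorem hilbertDim_eq_of_linearIsometryEquiv (e : H ≃ₗᵢ[ℂ] K) [CompleteSpace H]
    [CompleteSpace K] : hilbertDim H = hilbertDim K := by
  have key : ∀ {H K : Type u} [NormedAddCommGroup H] [InnerProductSpace ℂ H]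
      [NormedAddCommGroup K] [InnerProductSpace ℂ K] [CompleteSpace H] [CompleteSpace K]
      (_ : H ≃ₗᵢ[ℂ] K),
      {κ | ∃ s : Set H, Nonempty (HilbertBasis s ℂ H) ∧ #s = κ} ⊆
        {κ | ∃ s : Set K, Nonempty (HilbertBasis s ℂ K) ∧ #s = κ} := by
    rintro H K _ _ _ _ _ _ e κ ⟨s, ⟨b⟩, rfl⟩
    let b₁ : HilbertBasis s ℂ K := ⟨e.symm.trans b.repr⟩
    let f := Equiv.ofInjective b₁ b₁.orthonormal_injective
    obtain ⟨b₂, -⟩ := b₁.exists_reindex f.symm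
    exact ⟨range b₁, ⟨b₂⟩, (Cardinal.mk_congr f).symm⟩
  exact congrArg sInf ((key e).antisymm (key e.symm))

theorem exists_hilbertBasis_mk_eq_hilbertDim [CompleteSpace H] :
    ∃ s : Set H, Nonempty (HilbertBasis s ℂ H) ∧ #s = hilbertDim H := by
  obtain ⟨w, b, -⟩ := exists_hilbertBasis ℂ H
  exact csInf_mem (s := {κ | ∃ s : Set H, Nonempty (HilbertBasis s ℂ H) ∧ #s = κ})
    ⟨#w, w, ⟨b⟩, rfl⟩

/-- The infimum of cardinals is attained, so equal dimensions yield bases that can be matched. Hence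
it is not needed here that all Hilbert bases have the same cardinality. -/
theorem hilbertDim_eq_iff [CompleteSpace H] [CompleteSpace K] :
    hilbertDim H = hilbertDim K ↔ Nonempty (H ≃ₗᵢ[ℂ] K) := by
  refine ⟨fun h => ?_, fun ⟨e⟩ => hilbertDim_eq_of_linearIsometryEquiv e⟩
  obtain ⟨s, ⟨b⟩, hs⟩ := exists_hilbertBasis_mk_eq_hilbertDim (H := H)
  obtain ⟨t, ⟨c⟩, ht⟩ := exists_hilbertBasis_mk_eq_hilbertDim (H := K)
  obtain ⟨e⟩ := Cardinal.eq.1 (hs.trans (h.trans ht.symm))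
  obtain ⟨c', -⟩ := c.exists_reindex e
  exact ⟨b.repr.trans c'.repr.symm⟩

/-- A countable Hilbert basis computes the Hilbert dimension. -/
theorem hilbertDim_eq_mk [CompleteSpace H] {ι : Type u} [Countable ι] (b : HilbertBasis ι ℂ H) :
    hilbertDim H = #ι := by
  refine le_antisymm (csInf_le' ?_) ?_
  · let f := Equiv.ofInjective b b.orthonormal_injective
    obtain ⟨b₂, -⟩ := b.exists_reindex f.symm
    exact ⟨range b, ⟨b₂⟩, (Cardinal.mk_congr f).symm⟩
  · obtain ⟨s, ⟨c⟩, hs⟩ := exists_hilbertBasis_mk_eq_hilbertDim (H := H)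
    rw [← hs]
    -- A finite basis `c` is an algebraic one, so the independent family `b` is no larger; an
    -- infinite one has at least `ℵ₀ ≥ #ι` elements.
    rcases finite_or_infinite s with hfin | hinf
    · have := Fintype.ofFinite s
      rw [c.toOrthonormalBasis.toBasis.mk_eq_rank'']
      exact b.orthonormal.linearIndependent.cardinal_le_rank
    · exact (Cardinal.mk_le_aleph0 (α := ι)).trans (Cardinal.aleph0_le_mk s)

end StarGraph

end HilbertDimension

/-! ### Extending isometries to unitary operators -/

section IsometryExtension

variable {H D : Type*} [NormedAddCommGroup H] [InnerProductSpace ℂ H] [CompleteSpace H]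
  [AddCommGroup D] [Module ℂ D]

omit [CompleteSpace H] in
theorem norm_add_eq_of_mem_orthogonal {g₁ g₂ m n : H} (hg : ‖g₁‖ = ‖g₂‖) (hm : ‖m‖ = ‖n‖)
    (h₁ : inner ℂ g₁ m = 0) (h₂ : inner ℂ g₂ n = 0) : ‖g₁ + m‖ = ‖g₂ + n‖ := by
  have h := norm_add_sq_eq_norm_sq_add_norm_sq_of_inner_eq_zero g₁ m h₁
  have h' := norm_add_sq_eq_norm_sq_add_norm_sq_of_inner_eq_zero g₂ n h₂
  rw [hg, hm, ← h'] at h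
  nlinarith [norm_nonneg (g₁ + m), norm_nonneg (g₂ + n)]

/-- The range is `R ⊔ Rᗮ`, whose orthogonal complement is `Rᗮ ⊓ Rᗮᗮ = ⊥`. Density suffices because
isometries extend by completeness, so `R` need not be closed. -/
theorem denseRange_coprod_orthogonal (g : D →ₗ[ℂ] H) :
    DenseRange (g.coprod (LinearMap.range g)ᗮ.subtype) := by
  have : Dense ((LinearMap.range (g.coprod (LinearMap.range g)ᗮ.subtype) : Submodule ℂ H) :
      Set H) := by
    rw [Submodule.dense_iff_topologicalClosure_eq_top,
      Submodule.topologicalClosure_eq_top_iff, LinearMap.range_coprod, Submodule.range_subtype,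
      ← Submodule.inf_orthogonal, Submodule.inf_orthogonal_eq_bot]
  rwa [LinearMap.coe_range] at this

/-- An isometry `g₁ u ↦ g₂ u` between two subspaces extends to a unitary operator if and only if
their orthogonal complements are isometrically isomorphic. -/
theorem exists_linearIsometryEquiv_extending_iff (g₁ g₂ : D →ₗ[ℂ] H)
    (hg : ∀ u, ‖g₁ u‖ = ‖g₂ u‖) :
    (∃ W : H ≃ₗᵢ[ℂ] H, ∀ u, W (g₁ u) = g₂ u) ↔
      Nonempty ((LinearMap.range g₁)ᗮ ≃ₗᵢ[ℂ] (LinearMap.range g₂)ᗮ) := by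
  constructor
  · rintro ⟨W, hW⟩
    have h : (LinearMap.range g₁).map W.toLinearEquiv.toLinearMap = LinearMap.range g₂ := by
      rw [← LinearMap.range_comp]
      exact congrArg LinearMap.range (LinearMap.ext hW)
    have h' : (LinearMap.range g₁)ᗮ.map W.toLinearEquiv.toLinearMap = (LinearMap.range g₂)ᗮ := by
      rw [← h]
      exact Submodule.map_orthogonal_equiv _ W
    exact ⟨(W.submoduleMap (LinearMap.range g₁)ᗮ).trans (LinearIsometryEquiv.ofEq _ _ h')⟩
  · rintro ⟨U⟩
    -- The candidate is `g₁ u + n ↦ g₂ u + U n`, written on the parameter space; it is isometric by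
    -- Pythagoras.
    let f := (LinearEquiv.refl ℂ D).prodCongr U.toLinearEquiv
    have hn : ∀ x : D × (LinearMap.range g₁)ᗮ,
        ‖g₂.coprod (LinearMap.range g₂)ᗮ.subtype (f x)‖ =
          ‖g₁.coprod (LinearMap.range g₁)ᗮ.subtype x‖ := by
      rintro ⟨u, n⟩
      refine norm_add_eq_of_mem_orthogonal (hg u).symm ?_ ?_ ?_
      · exact U.norm_map n
      · exact (U n).2 _ ⟨u, rfl⟩
      · exact n.2 _ ⟨u, rfl⟩
    refine ⟨f.extendOfIsometry _ _ (denseRange_coprod_orthogonal g₁)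
      (denseRange_coprod_orthogonal g₂) hn, fun u => ?_⟩
    simpa [f] using f.extendOfIsometry_eq _ _ (denseRange_coprod_orthogonal g₁)
      (denseRange_coprod_orthogonal g₂) hn (u, 0)

end IsometryExtension

/-! ### Cayley transform and skew-self-adjoint extensions -/

section SkewSelfAdjointExtensions

namespace StarGraph

variable {H : Type u} [NormedAddCommGroup H] [InnerProductSpace ℂ H]

/-- `A` is skew-symmetric: `⟪A x, y⟫ = -⟪x, A y⟫` on its domain. -/
def IsSkewSymmetricOp (A : H →ₗ.[ℂ] H) : Prop :=
  ∀ x y : A.domain, inner ℂ (A x) (y : H) = -inner ℂ (x : H) (A y)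

theorem IsSkewSymmetricOp.re_inner_eq_zero {A : H →ₗ.[ℂ] H} (hA : IsSkewSymmetricOp A)
    (x : A.domain) : (inner ℂ (A x) (x : H)).re = 0 := by
  have h := congrArg Complex.re (hA x x)
  rw [← inner_conj_symm (x : H) (A x)] at h
  simp only [Complex.neg_re, Complex.conj_re] at h
  linarith

theorem IsSkewSymmetricOp.norm_add_sq {A : H →ₗ.[ℂ] H} (hA : IsSkewSymmetricOp A)
    (x : A.domain) : ‖A x + x‖ ^ 2 = ‖A x‖ ^ 2 + ‖(x : H)‖ ^ 2 := by
  have h := _root_.norm_add_sq (𝕜 := ℂ) (A x) (x : H)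
  rw [h]
  simp [hA.re_inner_eq_zero x]

theorem IsSkewSymmetricOp.norm_sub_sq {A : H →ₗ.[ℂ] H} (hA : IsSkewSymmetricOp A)
    (x : A.domain) : ‖A x - x‖ ^ 2 = ‖A x‖ ^ 2 + ‖(x : H)‖ ^ 2 := by
  have h := _root_.norm_sub_sq (𝕜 := ℂ) (A x) (x : H)
  rw [h]
  simp [hA.re_inner_eq_zero x]

theorem IsSkewSymmetricOp.norm_sub_eq_norm_add {A : H →ₗ.[ℂ] H} (hA : IsSkewSymmetricOp A)
    (x : A.domain) : ‖A x - x‖ = ‖A x + x‖ := by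
  have h := (hA.norm_sub_sq x).trans (hA.norm_add_sq x).symm
  exact (sq_eq_sq₀ (norm_nonneg _) (norm_nonneg _)).1 h

variable [CompleteSpace H]

/-- The operator `(W - 1) x ↦ (W + 1) x`, the inverse Cayley transform of `W`. -/
noncomputable def inverseCayley (W : H ≃ₗᵢ[ℂ] H)
    (hW : Function.Injective (W.toLinearEquiv.toLinearMap - LinearMap.id : H →ₗ[ℂ] H)) :
    H →ₗ.[ℂ] H where
  domain := LinearMap.range (W.toLinearEquiv.toLinearMap - LinearMap.id : H →ₗ[ℂ] H)
  toFun := (W.toLinearEquiv.toLinearMap + LinearMap.id) ∘ₗ (LinearEquiv.ofInjective _ hW).symm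

omit [CompleteSpace H] in
theorem inverseCayley_apply (W : H ≃ₗᵢ[ℂ] H)
    (hW : Function.Injective (W.toLinearEquiv.toLinearMap - LinearMap.id : H →ₗ[ℂ] H))
    (y : (inverseCayley W hW).domain) (x : H) (h : (y : H) = W x - x) :
    inverseCayley W hW y = W x + x := by
  have : (LinearEquiv.ofInjective _ hW).symm y = x :=
    (LinearEquiv.symm_apply_eq _).2 (Subtype.ext h)
  exact congrArg (W.toLinearEquiv.toLinearMap + LinearMap.id : H →ₗ[ℂ] H) this

theorem isSkewSelfAdjoint_inverseCayley (W : H ≃ₗᵢ[ℂ] H)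
    (hW : Function.Injective (W.toLinearEquiv.toLinearMap - LinearMap.id : H →ₗ[ℂ] H))
    (hd : Dense ((inverseCayley W hW).domain : Set H)) :
    IsSkewSelfAdjoint (inverseCayley W hW) := by
  set B := inverseCayley W hW with hB
  refine ⟨hd, ?_⟩
  have hle : -B ≤ B† := by
    refine LinearPMap.IsFormalAdjoint.le_adjoint hd ?_
    intro x y
    obtain ⟨x', hx'⟩ := x.2
    obtain ⟨y', hy'⟩ := y.2
    rw [LinearPMap.neg_apply, inverseCayley_apply W hW x x' hx'.symm,
      inverseCayley_apply W hW y y' hy'.symm, ← hx', ← hy']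
    simp only [LinearMap.sub_apply, LinearEquiv.coe_coe, LinearMap.id_apply,
      LinearIsometryEquiv.coe_toLinearEquiv, inner_add_left, inner_sub_right, inner_sub_left,
      inner_neg_right, inner_add_right, LinearIsometryEquiv.inner_map_map]
    ring
  refine (LinearPMap.eq_of_le_of_domain_eq hle (le_antisymm hle.1 ?_)).symm
  intro y hy
  set z := B† ⟨y, hy⟩ with hz
  have key : ∀ x : H, inner ℂ z (W x - x) = inner ℂ y (W x + x) := by
    intro x
    have h := LinearPMap.adjoint_isFormalAdjoint hd ⟨y, hy⟩ ⟨W x - x, x, rfl⟩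
    rwa [inverseCayley_apply W hW _ x rfl] at h
  -- Since `W` is onto, testing `key` with `x = W⁻¹ w` for all `w` determines `W (z + y)`. Solving
  -- for `y` then gives `y = (W - 1)(-(z + y) / 2)`, which lies in the domain.
  have hyz : W (z + y) = z - y := by
    refine ext_inner_right ℂ fun w => ?_
    have h := key (W.symm w)
    rw [← W.apply_symm_apply w, W.inner_map_map]
    rw [W.apply_symm_apply] at h ⊢
    simp only [inner_add_left, inner_sub_left, inner_sub_right, inner_add_right] at h ⊢
    linear_combination -h
  refine ⟨-(2⁻¹ : ℂ) • (z + y), ?_⟩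
  simp only [LinearMap.sub_apply, LinearEquiv.coe_coe, LinearIsometryEquiv.coe_toLinearEquiv,
    LinearMap.id_apply, map_smul, hyz]
  module

/-- A densely defined skew-symmetric operator has a skew-self-adjoint extension if and only if its
Cayley transform extends to a unitary operator. -/
theorem exists_isSkewSelfAdjoint_iff_exists_unitary {A : H →ₗ.[ℂ] H}
    (hd : Dense (A.domain : Set H)) :
    (∃ B, A ≤ B ∧ IsSkewSelfAdjoint B) ↔
      ∃ W : H ≃ₗᵢ[ℂ] H, ∀ x : A.domain, W (A x - x) = A x + x := by
  constructor
  · rintro ⟨B, hAB, hBd, hB⟩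
    have hskew : IsSkewSymmetricOp B := by
      intro x y
      have h := LinearPMap.adjoint_isFormalAdjoint hBd
      rw [hB] at h
      have h' := h x y
      rw [LinearPMap.neg_apply, inner_neg_left] at h'
      rw [← h', neg_neg]
    -- A vector `y` orthogonal to `ran (B + c)` lies in `D(B*) = D(B)` and satisfies `B y = c̄ y`.
    -- As `Re ⟪B y, y⟫ = 0` and `c` is real and nonzero, `y = 0`.
    have hbij : ∀ c : ℂ, c ≠ 0 → c.im = 0 →
        (LinearMap.range (B.toFun + c • B.domain.subtype))ᗮ = ⊥ := by
      intro c hc hc'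
      rw [Submodule.eq_bot_iff]
      intro y hy
      have h : ∀ x : B.domain, inner ℂ (-(starRingEnd ℂ c) • y) (x : H) = inner ℂ y (B x) := by
        intro x
        have h := Submodule.inner_left_of_mem_orthogonal (LinearMap.mem_range_self _ x) hy
        simp only [LinearMap.add_apply, LinearMap.smul_apply, Submodule.subtype_apply,
          inner_add_right, inner_smul_right] at h
        rw [inner_smul_left]
        simp only [map_neg, Complex.conj_conj]
        exact (by linear_combination -h : -c * inner ℂ y (x : H) = inner ℂ y (B.toFun x))
      have hy' := LinearPMap.mem_adjoint_domain_of_exists (T := B) y ⟨_, h⟩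
      have hval := LinearPMap.adjoint_apply_eq hBd ⟨y, hy'⟩ h
      have hyB : y ∈ B.domain := by rw [hB] at hy'; exact hy'
      have hval' : B ⟨y, hyB⟩ = starRingEnd ℂ c • y := by
        have := (LinearPMap.ext_iff.1 hB).2 (x := y) (hf := hy') (hg := hyB)
        rw [hval, LinearPMap.neg_apply, neg_smul, neg_inj] at this
        exact this.symm
      have h0 := hskew.re_inner_eq_zero ⟨y, hyB⟩
      rw [hval', inner_smul_left, Complex.conj_conj, inner_self_eq_norm_sq_to_K] at h0
      have hcr : c.re ≠ 0 := fun h => hc (Complex.ext h hc')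
      have h1 : c.re * ‖y‖ ^ 2 = 0 := by
        have : ((c : ℂ) * ((‖y‖ : ℝ) : ℂ) ^ 2).re = c.re * ‖y‖ ^ 2 := by
          rw [← Complex.ofReal_pow, Complex.re_mul_ofReal]
        rw [← this]; exact h0
      simpa [hcr] using h1
    have h1 := hbij 1 one_ne_zero rfl
    have h2 := hbij (-1) (by simp) (by simp)
    obtain ⟨W, hW⟩ := (exists_linearIsometryEquiv_extending_iff
      (B.toFun + (-1 : ℂ) • B.domain.subtype) (B.toFun + (1 : ℂ) • B.domain.subtype) (by
        intro x
        have := hskew.norm_sub_eq_norm_add x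
        simpa [sub_eq_add_neg] using this)).2 ⟨by rw [h1, h2]; exact LinearIsometryEquiv.refl ℂ _⟩
    refine ⟨W, fun x => ?_⟩
    have hx : A x = B ⟨x, hAB.1 x.2⟩ := hAB.2 rfl
    have := hW ⟨x, hAB.1 x.2⟩
    rw [hx]
    simpa [sub_eq_add_neg] using this
  · rintro ⟨W, hW⟩
    have h2 : ∀ x : A.domain, W (A x - x) - (A x - x) = (2 : ℂ) • (x : H) := by
      intro x
      rw [hW]
      module
    -- A fixed vector of the unitary `W` is orthogonal to `ran (W - 1)`, which by `h2` contains the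
    -- dense domain of `A`.
    have hinj : Function.Injective
        (W.toLinearEquiv.toLinearMap - LinearMap.id : H →ₗ[ℂ] H) := by
      rw [injective_iff_map_eq_zero]
      intro y hy
      have hy' : W y = y := sub_eq_zero.1 hy
      refine hd.eq_zero_of_inner_left ℂ fun x hx => ?_
      have h := congrArg (inner ℂ y) (h2 ⟨x, hx⟩)
      rw [inner_smul_right, inner_sub_right] at h
      nth_rewrite 1 [← hy'] at h
      rw [W.inner_map_map, sub_self] at h
      simpa using h.symm
    have hmem : ∀ x : A.domain, (x : H) =
        W ((2⁻¹ : ℂ) • (A x - x)) - (2⁻¹ : ℂ) • (A x - x) := by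
      intro x
      rw [map_smul, ← smul_sub, h2, smul_smul]
      simp
    have hle : A.domain ≤ (inverseCayley W hinj).domain := fun x hx =>
      ⟨_, (hmem ⟨x, hx⟩).symm⟩
    refine ⟨inverseCayley W hinj, ⟨hle, fun x y hxy => ?_⟩,
      isSkewSelfAdjoint_inverseCayley W hinj (hd.mono hle)⟩
    rw [inverseCayley_apply W hinj y _ (hxy.symm.trans (hmem x)), map_smul, hW]
    module

/-- A densely defined skew-symmetric operator `A` has a skew-self-adjoint extension if and only if
the orthogonal complements of the ranges of `A - 1` and `A + 1` have the same dimension. -/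
theorem exists_isSkewSelfAdjoint_iff_hilbertDim_eq {A : H →ₗ.[ℂ] H}
    (hd : Dense (A.domain : Set H)) (hA : IsSkewSymmetricOp A) :
    (∃ B, A ≤ B ∧ IsSkewSelfAdjoint B) ↔
      hilbertDim (defectSpace A 1) = hilbertDim (defectSpace A (-1)) := by
  rw [exists_isSkewSelfAdjoint_iff_exists_unitary hd]
  unfold defectSpace
  rw [hilbertDim_eq_iff, ← exists_linearIsometryEquiv_extending_iff]
  · simp
  · intro x
    simpa using hA.norm_sub_eq_norm_add x

omit [CompleteSpace H] in
/-- Multiplication by `i` turns the defect spaces at `±i` into those at `±1`. -/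
theorem defectSpace_I_smul (A : H →ₗ.[ℂ] H) (c : ℂ) :
    defectSpace (Complex.I • A) (c * Complex.I) = defectSpace A c := by
  unfold defectSpace
  have : (Complex.I • A).toFun - (c * Complex.I) • (Complex.I • A).domain.subtype =
      Complex.I • (A.toFun - c • A.domain.subtype) := by
    rw [smul_sub, smul_smul, mul_comm c]
    rfl
  rw [this]
  exact congrArg _ (LinearMap.range_smul _ _ Complex.I_ne_zero)

end StarGraph

end SkewSelfAdjointExtensions

namespace StarGraph

/-! ### First-order operators and exponential functionals on test functions -/

section TestFunctions

variable {Ω : Set ℝ}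

theorem TestFun.hasDerivAt (φ : TestFun Ω) (x : ℝ) :
    HasDerivAt φ.1 ((derivTest Ω φ).1 x) x :=
  ((φ.2.1.differentiable (by simp)) x).hasDerivAt

theorem TestFun.integrable_mul (φ : TestFun Ω) {f : ℝ → ℂ} (hf : Continuous f) :
    Integrable (fun x => f x * φ.1 x) :=
  (hf.mul φ.2.1.continuous).integrable_of_hasCompactSupport φ.2.2.1.mul_left

theorem TestFun.eq_zero_of_notMem (φ : TestFun Ω) {x : ℝ} (hx : x ∉ Ω) : φ.1 x = 0 :=
  image_eq_zero_of_notMem_tsupport fun h => hx (φ.2.2.2 h)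

theorem TestFun.integral_mul_deriv (φ : TestFun Ω) {f f' : ℝ → ℂ}
    (hf : ∀ x, HasDerivAt f (f' x) x) (hf' : Continuous f') :
    ∫ x, f x * (derivTest Ω φ).1 x = -∫ x, f' x * φ.1 x := by
  have hc : Continuous f := continuous_iff_continuousAt.2 fun x => (hf x).continuousAt
  exact integral_mul_deriv_eq_deriv_mul_of_integrable (fun x _ => hf x)
    (fun x _ => TestFun.hasDerivAt φ x) (TestFun.integrable_mul (derivTest Ω φ) hc) (TestFun.integrable_mul φ hf')
    (TestFun.integrable_mul φ hc)

/-- The functional `φ ↦ ∫ f φ` on test functions. -/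
noncomputable def pairing (Ω : Set ℝ) (f : ℝ → ℂ) (hf : Continuous f) : TestFun Ω →ₗ[ℂ] ℂ where
  toFun φ := ∫ x, f x * φ.1 x
  map_add' φ ψ := by
    rw [← integral_add (TestFun.integrable_mul φ hf) (TestFun.integrable_mul ψ hf)]
    simp [mul_add]
  map_smul' c φ := by
    rw [RingHom.id_apply, smul_eq_mul, ← integral_const_mul]
    simp [mul_left_comm]

theorem continuous_exp_neg_mul (μ : ℂ) : Continuous fun x : ℝ => Complex.exp (-(μ * x)) := by
  fun_prop

/-- The functional `φ ↦ ∫ e^{-μ x} φ(x) dx` on test functions. -/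
noncomputable def laplaceTest (Ω : Set ℝ) (μ : ℂ) : TestFun Ω →ₗ[ℂ] ℂ :=
  pairing Ω (fun x => Complex.exp (-(μ * x))) (continuous_exp_neg_mul μ)

theorem laplaceTest_apply (μ : ℂ) (φ : TestFun Ω) :
    laplaceTest Ω μ φ = ∫ x : ℝ, Complex.exp (-(μ * x)) * φ.1 x := rfl

/-- The operator `φ ↦ φ' - μ φ` on test functions. -/
noncomputable def shiftedDeriv (Ω : Set ℝ) (μ : ℂ) : Module.End ℂ (TestFun Ω) :=
  derivTest Ω - μ • 1

theorem shiftedDeriv_apply (μ : ℂ) (φ : TestFun Ω) (x : ℝ) :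
    (shiftedDeriv Ω μ φ).1 x = (derivTest Ω φ).1 x - μ * φ.1 x := rfl

theorem hasDerivAt_exp_neg_mul (μ : ℂ) (x : ℝ) :
    HasDerivAt (fun x : ℝ => Complex.exp (-(μ * x))) (-μ * Complex.exp (-(μ * x))) x := by
  have h : HasDerivAt (fun x : ℝ => -(μ * (x : ℂ))) (-μ) x := by
    simpa using ((hasDerivAt_id x).ofReal_comp.const_mul μ).fun_neg
  simpa [mul_comm] using h.cexp

/-- Integration by parts: the transpose of `d/dx - ν` is `-d/dx - ν`, which annihilates `e^{-ν x}`.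
-/
theorem integral_mul_shiftedDeriv (φ : TestFun Ω) (ν : ℂ) {f f' : ℝ → ℂ}
    (hf : ∀ x, HasDerivAt f (f' x) x) (hf' : Continuous f') :
    ∫ x, f x * (shiftedDeriv Ω ν φ).1 x = ∫ x, (-f' x - ν * f x) * φ.1 x := by
  have hc : Continuous f := continuous_iff_continuousAt.2 fun x => (hf x).continuousAt
  have hνc : Continuous fun x => ν * f x := continuous_const.mul hc
  have h1 := TestFun.integral_mul_deriv φ hf hf'
  have h2 : ∀ x, f x * (shiftedDeriv Ω ν φ).1 x =
      f x * (derivTest Ω φ).1 x - ν * f x * φ.1 x := by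
    intro x
    rw [shiftedDeriv_apply]
    ring
  have h3 : ∀ x, (-f' x - ν * f x) * φ.1 x = -(f' x * φ.1 x) - ν * f x * φ.1 x :=
    fun x => by ring
  simp_rw [h2, h3]
  rw [integral_sub (TestFun.integrable_mul (derivTest Ω φ) hc)
      (TestFun.integrable_mul φ hνc), h1,
    integral_sub (f := fun x => -(f' x * φ.1 x)) (TestFun.integrable_mul φ hf').neg (TestFun.integrable_mul φ hνc),
    integral_neg]

theorem laplaceTest_shiftedDeriv (μ : ℂ) (φ : TestFun Ω) :
    laplaceTest Ω μ (shiftedDeriv Ω μ φ) = 0 := by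
  rw [laplaceTest_apply, integral_mul_shiftedDeriv φ μ (hasDerivAt_exp_neg_mul μ) (by fun_prop)]
  simp

theorem exists_laplaceTest_eq_one (hΩ : IsOpen Ω) (hne : Ω.Nonempty) (μ : ℂ) :
    ∃ φ : TestFun Ω, laplaceTest Ω μ φ = 1 := by
  obtain ⟨x₀, hx₀⟩ := hne
  obtain ⟨ε, hε, hball⟩ := Metric.isOpen_iff.1 hΩ x₀ hx₀
  let b : ContDiffBump x₀ := ⟨ε / 4, ε / 2, by positivity, by linarith⟩
  -- The factor `e^{μ x}` cancels the weight, leaving the positive integral of the bump.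
  let g : ℝ → ℂ := fun x => Complex.exp (μ * x) * (b x : ℂ)
  have hsub : tsupport g ⊆ tsupport (fun x => (b x : ℂ)) := tsupport_mul_subset_right
  have hsub' : tsupport (fun x => (b x : ℂ)) ⊆ tsupport b :=
    closure_mono fun x hx => by simpa using hx
  have hg : g ∈ TestFun Ω := by
    refine ⟨?_, ?_, ?_⟩
    · refine ContDiff.mul ?_ (Complex.ofRealCLM.contDiff.comp b.contDiff)
      exact (contDiff_const.mul Complex.ofRealCLM.contDiff).cexp
    · exact b.hasCompactSupport.of_isClosed_subset (isClosed_tsupport g) (hsub.trans hsub')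
    · refine (hsub.trans hsub').trans ?_
      rw [b.tsupport_eq]
      exact (Metric.closedBall_subset_ball (by simp [b, hε])).trans hball
  have hval : laplaceTest Ω μ ⟨g, hg⟩ = ((∫ x, b x : ℝ) : ℂ) := by
    rw [laplaceTest_apply, ← integral_complex_ofReal]
    refine integral_congr_ae (ae_of_all _ fun x => ?_)
    simp only [g]
    rw [← mul_assoc, ← Complex.exp_add]
    simp
  have hpos : ((∫ x, b x : ℝ) : ℂ) ≠ 0 := Complex.ofReal_ne_zero.2 b.integral_pos.ne'
  refine ⟨((∫ x, b x : ℝ) : ℂ)⁻¹ • ⟨g, hg⟩, ?_⟩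
  rw [map_smul, hval, smul_eq_mul, inv_mul_cancel₀ hpos]

/-- On an interval, `φ' - μ φ = ψ` is solvable in test functions if `∫ e^{-μ x} ψ(x) dx = 0`. -/
theorem exists_shiftedDeriv_eq (hΩ : Ω.OrdConnected) (μ : ℂ) (ψ : TestFun Ω)
    (hψ : laplaceTest Ω μ ψ = 0) : ∃ φ, shiftedDeriv Ω μ φ = ψ := by
  rcases (tsupport ψ.1).eq_empty_or_nonempty with he | hne
  · refine ⟨0, ?_⟩
    rw [map_zero]
    ext x
    exact (image_eq_zero_of_notMem_tsupport (by rw [he]; exact notMem_empty x)).symm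
  have hK : IsCompact (tsupport ψ.1) := ψ.2.2.1
  set a := sInf (tsupport ψ.1)
  set b := sSup (tsupport ψ.1)
  have hab : Icc a b ⊆ Ω := hΩ.out (ψ.2.2.2 (hK.sInf_mem hne)) (ψ.2.2.2 (hK.sSup_mem hne))
  let g : ℝ → ℂ := fun x => Complex.exp (-(μ * x)) * ψ.1 x
  have hgc : Continuous g := (continuous_exp_neg_mul μ).mul ψ.2.1.continuous
  have hg0 : ∀ x, x ∉ Icc a b → g x = 0 := by
    intro x hx
    have : x ∉ tsupport ψ.1 := fun h => hx ⟨csInf_le hK.bddBelow h, le_csSup hK.bddAbove h⟩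
    simp [g, image_eq_zero_of_notMem_tsupport this]
  -- Variation of constants: the solution is `e^{μ x} G x`. Starting at `a - 1` keeps `a` inside the
  -- half-open interval of integration; beyond `b`, `G` equals the total integral, which is zero by
  -- `hψ`.
  let G : ℝ → ℂ := fun x => ∫ t in (a - 1)..x, g t
  have hG : ∀ x, HasDerivAt G (g x) x := fun x => (hgc.integral_hasStrictDerivAt _ x).hasDerivAt
  have hG0 : ∀ x, x ∉ Icc a b → G x = 0 := by
    intro x hx
    rcases lt_or_ge x a with h | h
    · refine intervalIntegral.integral_zero_ae (ae_of_all _ fun t ht => hg0 t fun ht' => ?_)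
      have := ht.2.trans (max_le (by linarith : a - 1 ≤ a) h.le)
      have hta : t = a := le_antisymm this ht'.1
      rw [uIoc, mem_Ioc, hta] at ht
      exact absurd ht.2 (not_le.2 (max_lt (by linarith) h))
    · have hb : b < x := not_le.1 fun h' => hx ⟨h, h'⟩
      have : Function.support g ⊆ Ioc (a - 1) x := fun t ht => by
        have ht' : t ∈ Icc a b := by_contra fun h => ht (hg0 t h)
        exact ⟨by linarith [ht'.1], by linarith [ht'.2]⟩
      exact (intervalIntegral.integral_eq_integral_of_support_subset this).trans hψ
  have hGs : ContDiff ℝ ∞ G := by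
    refine contDiff_infty_iff_deriv.2 ⟨fun x => (hG x).differentiableAt, ?_⟩
    rw [show deriv G = g from funext fun x => (hG x).deriv]
    exact (contDiff_const.mul Complex.ofRealCLM.contDiff).neg.cexp.mul ψ.2.1
  have hs : tsupport (fun x : ℝ => Complex.exp (μ * x) * G x) ⊆ Icc a b := by
    refine closure_minimal (fun x hx => ?_) isClosed_Icc
    by_contra h
    exact hx (by simp [hG0 x h])
  refine ⟨⟨fun x => Complex.exp (μ * x) * G x,
    (contDiff_const.mul Complex.ofRealCLM.contDiff).cexp.mul hGs,
    isCompact_Icc.of_isClosed_subset (isClosed_tsupport _) hs, hs.trans hab⟩, ?_⟩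
  ext x
  rw [shiftedDeriv_apply]
  have he : HasDerivAt (fun x : ℝ => Complex.exp (μ * x)) (μ * Complex.exp (μ * x)) x := by
    simpa using hasDerivAt_exp_neg_mul (-μ) x
  have hd := ((he.mul (hG x)).deriv)
  change deriv (fun x : ℝ => Complex.exp (μ * x) * G x) x - μ * (Complex.exp (μ * x) * G x) = _
  rw [show (fun x : ℝ => Complex.exp (μ * x) * G x) = (fun x : ℝ => Complex.exp (μ * x)) * G from
    rfl, hd]
  have : Complex.exp (μ * x) * g x = ψ.1 x := by
    simp only [g]
    rw [← mul_assoc, ← Complex.exp_add]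
    simp
  rw [this]
  ring

/-- A functional vanishing on the range of `d/dx - μ` is a multiple of `∫ e^{-μ x} φ(x) dx`. -/
theorem eq_laplaceTest_of_comp_shiftedDeriv_eq_zero (hΩ : Ω.OrdConnected) {μ : ℂ}
    {l : TestFun Ω →ₗ[ℂ] ℂ} (hl : ∀ φ, l (shiftedDeriv Ω μ φ) = 0) {φ₀ : TestFun Ω}
    (hφ₀ : laplaceTest Ω μ φ₀ = 1) (ψ : TestFun Ω) : l ψ = l φ₀ * laplaceTest Ω μ ψ := by
  obtain ⟨φ, hφ⟩ := exists_shiftedDeriv_eq hΩ μ (ψ - laplaceTest Ω μ ψ • φ₀) (by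
    simp [hφ₀])
  have h := hl φ
  rw [hφ, map_sub, map_smul, sub_eq_zero] at h
  rw [h, smul_eq_mul, mul_comm]

/-- The translation `φ ↦ φ(· - τ)`, for `Ω + τ ⊆ Ω`. -/
noncomputable def translateTest (τ : ℝ) (hτ : ∀ x ∈ Ω, x + τ ∈ Ω) :
    Module.End ℂ (TestFun Ω) where
  toFun φ := ⟨fun x => φ.1 (x - τ), by
    have h : tsupport (fun x => φ.1 (x - τ)) = (Homeomorph.subRight τ) ⁻¹' tsupport φ.1 :=
      tsupport_comp_eq_preimage φ.1 (Homeomorph.subRight τ)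
    refine ⟨φ.2.1.comp (contDiff_id.sub contDiff_const), ?_, ?_⟩
    · exact φ.2.2.1.comp_homeomorph (Homeomorph.subRight τ)
    · rw [h]
      intro x hx
      simpa using hτ _ (φ.2.2.2 hx)⟩
  map_add' _ _ := rfl
  map_smul' _ _ := rfl

theorem shiftedDeriv_commute_translateTest (μ : ℂ) (τ : ℝ) (hτ : ∀ x ∈ Ω, x + τ ∈ Ω) :
    Commute (shiftedDeriv Ω μ) (translateTest τ hτ) := by
  refine LinearMap.ext fun φ => Subtype.ext (funext fun x => ?_)
  exact congrArg (· - μ * φ.1 (x - τ)) (deriv_comp_sub_const (f := φ.1) τ x)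

theorem laplaceTest_translateTest (μ : ℂ) (τ : ℝ) (hτ : ∀ x ∈ Ω, x + τ ∈ Ω) (φ : TestFun Ω) :
    laplaceTest Ω μ (translateTest τ hτ φ) = Complex.exp (-(μ * τ)) * laplaceTest Ω μ φ := by
  rw [laplaceTest_apply, laplaceTest_apply, ← integral_const_mul,

    ← integral_sub_right_eq_self (fun x => Complex.exp (-(μ * τ)) * _) τ]
  refine integral_congr_ae (ae_of_all _ fun x => ?_)
  change Complex.exp (-(μ * x)) * φ.1 (x - τ) = _
  simp only
  rw [← mul_assoc, ← Complex.exp_add]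
  congr 2
  push_cast
  ring

/-- Passing to Lebesgue measure on the whole line makes translation invariance available, which the
restricted measure lacks in general. -/
theorem norm_testToL2 (φ : TestFun Ω) :
    ‖testToL2 Ω φ‖ = (eLpNorm φ.1 2 volume).toReal := by
  change ‖(testFun_memLp φ).toLp φ.1‖ = _
  rw [Lp.norm_toLp, eLpNorm_restrict_eq_of_support_subset]
  intro x hx
  by_contra h
  exact hx (TestFun.eq_zero_of_notMem φ h)

theorem norm_testToL2_translateTest (τ : ℝ) (hτ : ∀ x ∈ Ω, x + τ ∈ Ω) (φ : TestFun Ω) :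
    ‖testToL2 Ω (translateTest τ hτ φ)‖ = ‖testToL2 Ω φ‖ := by
  rw [norm_testToL2, norm_testToL2]
  exact congrArg _ (eLpNorm_comp_measurePreserving φ.2.1.continuous.aestronglyMeasurable
    (measurePreserving_sub_right volume τ))

theorem inner_toLp_testToL2 {f : ℝ → ℂ} (hf : MemLp f 2 (volume.restrict Ω)) (φ : TestFun Ω) :
    inner ℂ (hf.toLp f) (testToL2 Ω φ) = ∫ x, φ.1 x * (starRingEnd ℂ) (f x) := by
  rw [L2.inner_def, ← setIntegral_eq_integral_of_forall_compl_eq_zero (s := Ω)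
    (f := fun x => φ.1 x * (starRingEnd ℂ) (f x))]
  · refine integral_congr_ae ?_
    filter_upwards [hf.coeFn_toLp, (testFun_memLp φ).coeFn_toLp] with x h1 h2
    rw [h1, RCLike.inner_apply]
    exact congrArg (· * _) h2
  · intro x hx
    rw [TestFun.eq_zero_of_notMem φ hx, zero_mul]

theorem exists_inner_testToL2_eq {f : ℝ → ℂ} (hf : MemLp f 2 (volume.restrict Ω)) :
    ∃ u : Lp ℂ 2 (volume.restrict Ω), ∀ φ : TestFun Ω,
      inner ℂ u (testToL2 Ω φ) = ∫ x, f x * φ.1 x := by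
  refine ⟨hf.star.toLp _, fun φ => ?_⟩
  rw [inner_toLp_testToL2]
  simp [mul_comm]

theorem inner_derivTest (φ ψ : TestFun Ω) :
    inner ℂ (testToL2 Ω (derivTest Ω φ)) (testToL2 Ω ψ) =
      -inner ℂ (testToL2 Ω φ) (testToL2 Ω (derivTest Ω ψ)) := by
  have h1 := inner_toLp_testToL2 (testFun_memLp (derivTest Ω φ)) ψ
  have h2 := inner_toLp_testToL2 (testFun_memLp φ) (derivTest Ω ψ)
  have h3 := TestFun.integral_mul_deriv ψ (f := fun x => (starRingEnd ℂ) (φ.1 x))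
    (f' := fun x => (starRingEnd ℂ) ((derivTest Ω φ).1 x))
    (fun x => (Complex.conjCLE.toContinuousLinearMap.hasFDerivAt.comp_hasDerivAt x
      (TestFun.hasDerivAt φ x)))
    (Complex.continuous_conj.comp (derivTest Ω φ).2.1.continuous)
  refine h1.trans (Eq.trans ?_ (congrArg Neg.neg h2).symm)
  simp_rw [mul_comm _ ((starRingEnd ℂ) _)]
  rw [h3, neg_neg]

theorem inner_airyTest (a b : ℝ) (φ ψ : TestFun Ω) :
    inner ℂ (testToL2 Ω (airyTest Ω a b φ)) (testToL2 Ω ψ) =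
      -inner ℂ (testToL2 Ω φ) (testToL2 Ω (airyTest Ω a b ψ)) := by
  simp only [airyTest, LinearMap.add_apply, LinearMap.smul_apply, LinearMap.comp_apply, map_add,
    map_smul, inner_add_left, inner_add_right, inner_smul_left, inner_smul_right,
    Complex.conj_ofReal, inner_derivTest]
  ring

end TestFunctions

end StarGraph

namespace StarGraph

/-! ### Annihilators of ranges, one factor at a time -/

section Annihilators

variable {Ω : Set ℝ}

/-- The orthogonal complement in `L²(Ω)` of the range of an operator on test functions. -/
noncomputable def testAnnihilator (Ω : Set ℝ) (q : Module.End ℂ (TestFun Ω)) :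
    Submodule ℂ (Lp ℂ 2 (volume.restrict Ω)) :=
  (LinearMap.range (testToL2 Ω ∘ₗ q))ᗮ

theorem mem_testAnnihilator {q : Module.End ℂ (TestFun Ω)} {u : Lp ℂ 2 (volume.restrict Ω)} :
    u ∈ testAnnihilator Ω q ↔ ∀ φ, inner ℂ u (testToL2 Ω (q φ)) = 0 := by
  rw [testAnnihilator, Submodule.mem_orthogonal']
  constructor
  · exact fun h φ => h _ ⟨φ, rfl⟩
  · rintro h _ ⟨φ, rfl⟩
    exact h φ

theorem testAnnihilator_smul {a : ℂ} (ha : a ≠ 0) (q : Module.End ℂ (TestFun Ω)) :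
    testAnnihilator Ω (a • q) = testAnnihilator Ω q := by
  unfold testAnnihilator
  rw [LinearMap.comp_smul, LinearMap.range_smul _ _ ha]

/-- Test functions are dense in `L²(Ω)`. -/
theorem testAnnihilator_one (hΩ : IsOpen Ω) : testAnnihilator Ω 1 = ⊥ := by
  rw [Submodule.eq_bot_iff]
  intro u hu
  rw [mem_testAnnihilator] at hu
  have hloc : LocallyIntegrableOn u Ω (volume.restrict Ω) :=
    ((Lp.memLp u).locallyIntegrable (by norm_num)).locallyIntegrableOn Ω
  have key := hΩ.ae_eq_zero_of_integral_contDiff_smul_eq_zero hloc (fun g hg hgc hgs => by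
    have hsub : tsupport (fun x => (g x : ℂ)) ⊆ tsupport g :=
      closure_mono fun x hx => by simpa using hx
    let φ : TestFun Ω := ⟨fun x => (g x : ℂ), Complex.ofRealCLM.contDiff.comp hg,
      hgc.of_isClosed_subset (isClosed_tsupport _) hsub, hsub.trans hgs⟩
    have h := inner_eq_zero_symm.1 (hu φ)
    rw [L2.inner_def] at h
    rw [← h]
    refine integral_congr_ae ?_
    filter_upwards [(testFun_memLp φ).coeFn_toLp] with x hx
    rw [RCLike.inner_apply]
    have : (testToL2 Ω φ : ℝ → ℂ) x = (g x : ℂ) := hx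
    rw [Module.End.one_apply, this, Complex.conj_ofReal, Complex.real_smul, mul_comm])
  rw [Lp.eq_zero_iff_ae_eq_zero]
  filter_upwards [key, ae_restrict_mem hΩ.measurableSet] with x h1 h2
  exact h1 h2

/-- The functions `e^{-ν x}`, multiplied by powers of `x`, are square integrable on `Ω`. -/
def DecaysOn (Ω : Set ℝ) (ν : ℂ) : Prop :=
  ∀ n : ℕ, MemLp (fun x : ℝ => (x : ℂ) ^ n * Complex.exp (-(ν * x))) 2 (volume.restrict Ω)

/-- `Ω` is invariant under a translation along which `e^{-μ x}` grows. -/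
def GrowsOn (Ω : Set ℝ) (μ : ℂ) : Prop :=
  ∃ τ : ℝ, (∀ x ∈ Ω, x + τ ∈ Ω) ∧ μ.re * τ < 0

theorem growsOn_Ioi {μ : ℂ} (hμ : μ.re < 0) : GrowsOn (Ioi 0) μ :=
  ⟨1, fun x hx => mem_Ioi.2 (add_pos (mem_Ioi.1 hx) one_pos), by simpa using hμ⟩

theorem growsOn_Iio {μ : ℂ} (hμ : 0 < μ.re) : GrowsOn (Iio 0) μ :=
  ⟨-1, fun x hx => mem_Iio.2 (add_neg (mem_Iio.1 hx) neg_one_lt_zero), by simpa using hμ⟩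

theorem norm_pow_mul_exp_sq (ν : ℂ) (n : ℕ) (x : ℝ) :
    ‖(x : ℂ) ^ n * Complex.exp (-(ν * x))‖ ^ 2 =
      x ^ (2 * n) * Real.exp (-(2 * ν.re) * x) := by
  rw [norm_mul, norm_pow, Complex.norm_real, Complex.norm_exp, mul_pow, ← pow_mul, mul_comm n,
    pow_mul, pow_mul, Real.norm_eq_abs, sq_abs, ← Real.exp_nat_mul]
  simp
  left
  ring

theorem memLp_pow_mul_exp_iff (ν : ℂ) (n : ℕ) :
    MemLp (fun x : ℝ => (x : ℂ) ^ n * Complex.exp (-(ν * x))) 2 (volume.restrict Ω) ↔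
      IntegrableOn (fun x : ℝ => x ^ (2 * n) * Real.exp (-(2 * ν.re) * x)) Ω := by
  rw [memLp_two_iff_integrable_sq_norm
    (by fun_prop : Continuous fun x : ℝ =>
      (x : ℂ) ^ n * Complex.exp (-(ν * x))).aestronglyMeasurable]
  simp_rw [norm_pow_mul_exp_sq]
  rfl

theorem integrableOn_pow_mul_exp_neg {b : ℝ} (hb : 0 < b) (n : ℕ) :
    IntegrableOn (fun x : ℝ => x ^ n * Real.exp (-b * x)) (Ioi 0) := by
  have h := integrableOn_rpow_mul_exp_neg_mul_rpow (p := 1) (s := n) (b := b)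
    (by linarith [n.cast_nonneg (α := ℝ)]) one_pos hb
  simpa using h

theorem decaysOn_Ioi {ν : ℂ} (hν : 0 < ν.re) : DecaysOn (Ioi 0) ν := fun n =>
  (memLp_pow_mul_exp_iff ν n).2 (integrableOn_pow_mul_exp_neg (by linarith) _)

theorem decaysOn_Iio {ν : ℂ} (hν : ν.re < 0) : DecaysOn (Iio 0) ν := fun n => by
  rw [memLp_pow_mul_exp_iff]
  have h := integrableOn_pow_mul_exp_neg (b := -(2 * ν.re)) (by linarith) (2 * n)
  rw [← neg_zero] at h
  have h' := h.comp_neg_Iio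
  refine h'.congr_fun (fun x _ => ?_) measurableSet_Iio
  simp [(even_two_mul n).neg_pow]

/-- A factor `d/dx - μ` for which `e^{-μ x}` grows on `Ω` does not contribute to the annihilator. -/
theorem testAnnihilator_mul_shiftedDeriv_of_growsOn (hΩ : IsOpen Ω) (hne : Ω.Nonempty)
    (hoc : Ω.OrdConnected) {μ : ℂ} (hμ : GrowsOn Ω μ) {q : Module.End ℂ (TestFun Ω)}
    (hq : ∀ τ (hτ : ∀ x ∈ Ω, x + τ ∈ Ω), Commute q (translateTest τ hτ)) :
    testAnnihilator Ω (q * shiftedDeriv Ω μ) = testAnnihilator Ω q := by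
  ext u
  simp only [mem_testAnnihilator, Module.End.mul_apply]
  refine ⟨fun hu => ?_, fun hu φ => hu _⟩
  obtain ⟨τ, hτ, hneg⟩ := hμ
  obtain ⟨φ₀, hφ₀⟩ := exists_laplaceTest_eq_one hΩ hne μ
  let l : TestFun Ω →ₗ[ℂ] ℂ := (innerₛₗ ℂ u) ∘ₗ testToL2 Ω ∘ₗ q
  have hl := eq_laplaceTest_of_comp_shiftedDeriv_eq_zero hoc (l := l) hu hφ₀
  -- Each translation by `τ` preserves the norm of `q φ₀`, as `q` commutes with it, but multiplies
  -- the exponential functional by `e^{-μ τ}`, of modulus greater than one. Boundedness in `n`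
  -- forces `l φ₀ = 0`.
  have hb : ∀ n : ℕ, ‖l φ₀‖ * Real.exp (-(μ.re * τ)) ^ n ≤ ‖u‖ * ‖testToL2 Ω (q φ₀)‖ := by
    intro n
    have h1 : ∀ n : ℕ, laplaceTest Ω μ ((translateTest τ hτ ^ n) φ₀) =
        Complex.exp (-(μ * τ)) ^ n := by
      intro n
      induction n with
      | zero => simpa using hφ₀
      | succ n ih => rw [pow_succ', Module.End.mul_apply, laplaceTest_translateTest, ih, pow_succ']
    have h2 : ∀ n : ℕ, ‖testToL2 Ω ((translateTest τ hτ ^ n) (q φ₀))‖ = ‖testToL2 Ω (q φ₀)‖ := by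
      intro n
      induction n with
      | zero => simp
      | succ n ih => rw [pow_succ', Module.End.mul_apply, norm_testToL2_translateTest, ih]
    have h3 : l ((translateTest τ hτ ^ n) φ₀) =
        inner ℂ u (testToL2 Ω ((translateTest τ hτ ^ n) (q φ₀))) :=
      congrArg (fun T : Module.End ℂ (TestFun Ω) => inner ℂ u (testToL2 Ω (T φ₀)))
        ((hq τ hτ).pow_right n).eq
    have h4 := norm_inner_le_norm (𝕜 := ℂ) u (testToL2 Ω ((translateTest τ hτ ^ n) (q φ₀)))
    rw [h2, ← h3, hl, h1, norm_mul, norm_pow, Complex.norm_exp] at h4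
    simpa using h4
  have h0 : l φ₀ = 0 := by
    by_contra hne
    have hpos := norm_pos_iff.2 hne
    obtain ⟨n, hn⟩ := pow_unbounded_of_one_lt (‖u‖ * ‖testToL2 Ω (q φ₀)‖ / ‖l φ₀‖)
      (Real.one_lt_exp_iff.2 (by linarith : 0 < -(μ.re * τ)))
    rw [div_lt_iff₀' hpos] at hn
    exact absurd (hb n) (not_le.2 hn)
  intro φ
  have := hl φ
  rw [h0, zero_mul] at this
  exact this

/-- A factor `d/dx - μ` raises the dimension of the annihilator by one, if the functional
`∫ e^{-μ x} φ(x) dx` is represented by an element of `L²(Ω)` on the range of the other factor. -/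
theorem rank_testAnnihilator_mul_shiftedDeriv (hΩ : IsOpen Ω) (hne : Ω.Nonempty)
    (hoc : Ω.OrdConnected) {μ : ℂ} {q : Module.End ℂ (TestFun Ω)}
    (hu : ∃ u : Lp ℂ 2 (volume.restrict Ω), ∀ φ,
      inner ℂ u (testToL2 Ω (q φ)) = laplaceTest Ω μ φ) :
    Module.rank ℂ (testAnnihilator Ω (q * shiftedDeriv Ω μ)) =
      1 + Module.rank ℂ (testAnnihilator Ω q) := by
  obtain ⟨u, hu⟩ := hu
  obtain ⟨φ₀, hφ₀⟩ := exists_laplaceTest_eq_one hΩ hne μ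
  let S := testAnnihilator Ω (q * shiftedDeriv Ω μ)
  -- For `v ∈ S` the functional `⟪v, q ·⟫` is a multiple of the exponential one, so its value at
  -- `φ₀` decides whether it vanishes. Thus `ker Λ` is the annihilator of `q`, and `u` makes `Λ`
  -- onto.
  let Λ : S →ₗ[ℂ] ℂ := (innerₛₗ ℂ (testToL2 Ω (q φ₀))) ∘ₗ S.subtype
  have huS : u ∈ S := mem_testAnnihilator.2 fun φ => by
    rw [Module.End.mul_apply, hu, laplaceTest_shiftedDeriv]
  have hΛ : Λ ⟨u, huS⟩ = 1 := by
    change inner ℂ (testToL2 Ω (q φ₀)) u = 1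
    rw [← inner_conj_symm, hu, hφ₀, map_one]
  have hsurj : Function.Surjective Λ := fun c => ⟨c • ⟨u, huS⟩, by rw [map_smul, hΛ]; simp⟩
  have hle : testAnnihilator Ω q ≤ S := fun v hv => mem_testAnnihilator.2 fun φ =>
    mem_testAnnihilator.1 hv _
  have hker : LinearMap.ker Λ = (testAnnihilator Ω q).comap S.subtype := by
    ext ⟨v, hv⟩
    rw [LinearMap.mem_ker, Submodule.mem_comap, mem_testAnnihilator]
    change inner ℂ (testToL2 Ω (q φ₀)) v = 0 ↔ ∀ φ, inner ℂ v (testToL2 Ω (q φ)) = 0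
    refine ⟨fun h φ => ?_, fun h => inner_eq_zero_symm.1 (h φ₀)⟩
    have h1 := eq_laplaceTest_of_comp_shiftedDeriv_eq_zero hoc
      (l := (innerₛₗ ℂ v) ∘ₗ testToL2 Ω ∘ₗ q) (mem_testAnnihilator.1 hv) hφ₀ φ
    have h2 : inner ℂ v (testToL2 Ω (q φ₀)) = 0 := inner_eq_zero_symm.1 h
    exact h1.trans (by rw [LinearMap.comp_apply, LinearMap.comp_apply, innerₛₗ_apply_apply, h2,
      zero_mul])
  have h := LinearMap.rank_range_add_rank_ker Λ
  rw [rank_range_of_surjective Λ hsurj, Module.rank_self, hker,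
    (Submodule.comapSubtypeEquivOfLe hle).rank_eq] at h
  exact h.symm

theorem rank_testAnnihilator_shiftedDeriv (hΩ : IsOpen Ω) (hne : Ω.Nonempty)
    (hoc : Ω.OrdConnected) {ν : ℂ} (hν : DecaysOn Ω ν) :
    Module.rank ℂ (testAnnihilator Ω (shiftedDeriv Ω ν)) = 1 := by
  have h := rank_testAnnihilator_mul_shiftedDeriv hΩ hne hoc (μ := ν) (q := 1) (by
    simpa [laplaceTest_apply] using exists_inner_testToL2_eq (hν 0))
  rw [one_mul] at h
  rw [h, testAnnihilator_one hΩ, rank_bot, add_zero]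

theorem rank_testAnnihilator_shiftedDeriv_mul (hΩ : IsOpen Ω) (hne : Ω.Nonempty)
    (hoc : Ω.OrdConnected) {ν μ : ℂ} (hν : DecaysOn Ω ν) (hμ : DecaysOn Ω μ) :
    Module.rank ℂ (testAnnihilator Ω (shiftedDeriv Ω ν * shiftedDeriv Ω μ)) = 2 := by
  rw [rank_testAnnihilator_mul_shiftedDeriv hΩ hne hoc,
    rank_testAnnihilator_shiftedDeriv hΩ hne hoc hν, one_add_one_eq_two]
  -- The representative must solve `-f' - ν f = e^{-μ x}`: take `-x e^{-μ x}` at a double root and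
  -- `(μ - ν)⁻¹ e^{-μ x}` otherwise.
  rcases eq_or_ne μ ν with rfl | hne
  · obtain ⟨u, hu⟩ := exists_inner_testToL2_eq (hμ 1).neg
    refine ⟨u, fun φ => ?_⟩
    rw [hu]
    have hd : ∀ x : ℝ, HasDerivAt (fun x : ℝ => -((x : ℂ) ^ 1 * Complex.exp (-(μ * x))))
        (-(Complex.exp (-(μ * x)) + x * (-μ * Complex.exp (-(μ * x))))) x := by
      intro x
      simpa using ((hasDerivAt_id x).ofReal_comp.fun_mul (hasDerivAt_exp_neg_mul μ x)).fun_neg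
    refine (integral_mul_shiftedDeriv φ μ hd (by fun_prop)).trans ?_
    rw [laplaceTest_apply]
    refine integral_congr_ae (ae_of_all _ fun x => ?_)
    simp only
    ring
  · obtain ⟨u, hu⟩ := exists_inner_testToL2_eq ((hμ 0).const_mul (μ - ν)⁻¹)
    refine ⟨u, fun φ => ?_⟩
    rw [hu]
    have hd : ∀ x : ℝ, HasDerivAt
        (fun x : ℝ => (μ - ν)⁻¹ * ((x : ℂ) ^ 0 * Complex.exp (-(μ * x))))
        ((μ - ν)⁻¹ * (-μ * Complex.exp (-(μ * x)))) x := by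
      intro x
      simpa using (hasDerivAt_exp_neg_mul μ x).const_mul (μ - ν)⁻¹
    refine (integral_mul_shiftedDeriv φ ν hd (by fun_prop)).trans ?_
    rw [laplaceTest_apply]
    refine integral_congr_ae (ae_of_all _ fun x => ?_)
    have : μ - ν ≠ 0 := sub_ne_zero.2 hne
    simp only
    field_simp

end Annihilators

/-! ### Roots of the cubic and the count on one half-line -/

section AiryAnnihilator

/-- The cubic `X³ + b X - c` with `c > 0` has one positive root and two roots in the left
half-plane. -/
theorem exists_roots_cubic (b : ℝ) {c : ℝ} (hc : 0 < c) :
    ∃ (r : ℝ) (μ₁ μ₂ : ℂ), 0 < r ∧ μ₁.re < 0 ∧ μ₂.re < 0 ∧ r + μ₁ + μ₂ = 0 ∧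
      r * μ₁ + r * μ₂ + μ₁ * μ₂ = b ∧ r * μ₁ * μ₂ = c := by
  obtain ⟨r, hr, hroot⟩ : ∃ r : ℝ, 0 < r ∧ r ^ 3 + b * r - c = 0 := by
    have hcont : ContinuousOn (fun x : ℝ => x ^ 3 + b * x - c) (Icc 0 (1 + |b| + c)) := by
      fun_prop
    have h0 := neg_abs_le b
    have h0' := abs_nonneg b
    have hle : (0 : ℝ) ≤ 1 + |b| + c := by positivity
    have hpos : (0 : ℝ) ≤ (1 + |b| + c) ^ 3 + b * (1 + |b| + c) - c := by
      nlinarith [mul_nonneg h0' hc.le, mul_nonneg hle hle, mul_nonneg hle (mul_nonneg hle hle),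
        mul_nonneg (by linarith : 0 ≤ b + |b|) hle, mul_nonneg hle h0', mul_nonneg hle hc.le]
    obtain ⟨r, hr, hr0⟩ := intermediate_value_Icc hle hcont
      (show (0 : ℝ) ∈ Icc _ _ from ⟨by simpa using hc.le, hpos⟩)
    refine ⟨r, lt_of_le_of_ne hr.1 ?_, hr0⟩
    rintro rfl
    simp at hr0
    linarith
  have hk : 0 < r ^ 2 + b := by
    have : r * (r ^ 2 + b) = c := by linarith
    exact pos_of_mul_pos_right (this ▸ hc) hr.le
  -- Dividing out `X - r` leaves `X² + r X + (r² + b)`, with discriminant `d²`. Its roots have sum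
  -- `-r < 0` and product `r² + b = c / r > 0`; they are real of equal sign or share the real part
  -- `-r / 2`.
  obtain ⟨d, hd⟩ := IsAlgClosed.exists_pow_nat_eq ((r : ℂ) ^ 2 - 4 * (r ^ 2 + b)) two_pos
  have hr' : r * (r ^ 2 + b) = c := by linarith
  have hsum : (-r + d) / 2 + (-r - d) / 2 = -(r : ℂ) := by ring
  have hprod : (-r + d) / 2 * ((-r - d) / 2) = (((r ^ 2 + b : ℝ)) : ℂ) := by
    push_cast
    linear_combination -hd / 4
  generalize (-r + d) / 2 = m₁ at hsum hprod
  generalize (-r - d) / 2 = m₂ at hsum hprod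
  have e1 := congrArg Complex.re hsum
  have e2 := congrArg Complex.im hsum
  have e3 := congrArg Complex.re hprod
  have e4 := congrArg Complex.im hprod
  simp only [Complex.add_re, Complex.add_im, Complex.neg_re, Complex.neg_im, Complex.ofReal_re,
    Complex.ofReal_im, Complex.mul_re, Complex.mul_im, neg_zero] at e1 e2 e3 e4
  have him : m₂.im = -m₁.im := by linarith
  rw [him] at e3 e4
  have h4 : m₁.im * (m₂.re - m₁.re) = 0 := by linarith
  have hneg : m₁.re < 0 ∧ m₂.re < 0 := by
    rcases mul_eq_zero.1 h4 with h | h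
    · rw [h] at e3
      have : 0 < m₁.re * m₂.re := by nlinarith
      rcases pos_and_pos_or_neg_and_neg_of_mul_pos this with h | h
      · linarith [h.1, h.2]
      · exact h
    · constructor <;> linarith
  refine ⟨r, m₁, m₂, hr, hneg.1, hneg.2, by linear_combination hsum, ?_, ?_⟩
  · push_cast at hprod
    linear_combination (r : ℂ) * hsum + hprod
  · rw [← hr', mul_assoc, hprod]
    push_cast
    ring

variable {Ω : Set ℝ}

theorem airyTest_sub_smul_one_eq {a b s : ℝ} {l₁ l₂ l₃ : ℂ} (h₁ : l₁ + l₂ + l₃ = 0)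
    (h₂ : a * (l₁ * l₂ + l₁ * l₃ + l₂ * l₃) = b) (h₃ : a * (l₁ * l₂ * l₃) = s) :
    (airyTest Ω a b - (s : ℂ) • 1 : Module.End ℂ (TestFun Ω)) =
      (a : ℂ) • (shiftedDeriv Ω l₁ * shiftedDeriv Ω l₂ * shiftedDeriv Ω l₃) := by
  refine LinearMap.ext fun φ => ?_
  simp only [airyTest, shiftedDeriv, Module.End.mul_apply, LinearMap.sub_apply,
    LinearMap.smul_apply, LinearMap.add_apply, LinearMap.comp_apply, Module.End.one_apply,
    map_sub, map_smul]
  rw [← h₂, ← h₃, eq_neg_of_add_eq_zero_right h₁]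
  module

/-- Growing factors stand on the right, where they can be dropped because the remaining product
commutes with translations. -/
theorem rank_testAnnihilator_of_decaysOn_one (hΩ : IsOpen Ω) (hne : Ω.Nonempty)
    (hoc : Ω.OrdConnected) {l₁ l₂ l₃ : ℂ} (h₁ : DecaysOn Ω l₁) (h₂ : GrowsOn Ω l₂)
    (h₃ : GrowsOn Ω l₃) :
    Module.rank ℂ (testAnnihilator Ω
      (shiftedDeriv Ω l₁ * shiftedDeriv Ω l₂ * shiftedDeriv Ω l₃)) = 1 := by
  rw [testAnnihilator_mul_shiftedDeriv_of_growsOn hΩ hne hoc h₃ fun τ hτ =>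
      (shiftedDeriv_commute_translateTest l₁ τ hτ).mul_left
        (shiftedDeriv_commute_translateTest l₂ τ hτ),
    testAnnihilator_mul_shiftedDeriv_of_growsOn hΩ hne hoc h₂ fun τ hτ =>
      shiftedDeriv_commute_translateTest l₁ τ hτ,
    rank_testAnnihilator_shiftedDeriv hΩ hne hoc h₁]

theorem rank_testAnnihilator_of_decaysOn_two (hΩ : IsOpen Ω) (hne : Ω.Nonempty)
    (hoc : Ω.OrdConnected) {l₁ l₂ l₃ : ℂ} (h₁ : DecaysOn Ω l₁) (h₂ : DecaysOn Ω l₂)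
    (h₃ : GrowsOn Ω l₃) :
    Module.rank ℂ (testAnnihilator Ω
      (shiftedDeriv Ω l₁ * shiftedDeriv Ω l₂ * shiftedDeriv Ω l₃)) = 2 := by
  rw [testAnnihilator_mul_shiftedDeriv_of_growsOn hΩ hne hoc h₃ fun τ hτ =>
      (shiftedDeriv_commute_translateTest l₁ τ hτ).mul_left
        (shiftedDeriv_commute_translateTest l₂ τ hτ),
    rank_testAnnihilator_shiftedDeriv_mul hΩ hne hoc h₁ h₂]

variable {a : ℝ} (ha : 0 < a) (b : ℝ)
include ha

/-- The roots of `a X³ + b X - 1` and, up to sign, of `a X³ + b X + 1`. -/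
theorem exists_roots_airy : ∃ (r : ℝ) (μ₁ μ₂ : ℂ), 0 < r ∧ μ₁.re < 0 ∧ μ₂.re < 0 ∧
    r + μ₁ + μ₂ = 0 ∧ a * (r * μ₁ + r * μ₂ + μ₁ * μ₂) = b ∧ a * (r * μ₁ * μ₂) = 1 := by
  obtain ⟨r, μ₁, μ₂, h0, h1, h2, h3, h4, h5⟩ := exists_roots_cubic (b / a) (inv_pos.2 ha)
  have ha' : (a : ℂ) ≠ 0 := Complex.ofReal_ne_zero.2 ha.ne'
  refine ⟨r, μ₁, μ₂, h0, h1, h2, h3, ?_, ?_⟩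
  · rw [h4]
    push_cast
    field_simp
  · rw [h5]
    push_cast
    field_simp

theorem rank_testAnnihilator_airy_sub_one_Ioi :
    Module.rank ℂ (testAnnihilator (Ioi 0) (airyTest (Ioi 0) a b - (1 : ℂ) • 1)) = 1 := by
  obtain ⟨r, μ₁, μ₂, h0, h1, h2, h3, h4, h5⟩ := exists_roots_airy ha b
  have h := airyTest_sub_smul_one_eq (Ω := Ioi 0) (a := a) (b := b) (s := 1) h3
    h4 (by simpa using h5)
  rw [Complex.ofReal_one] at h
  rw [h, testAnnihilator_smul (Complex.ofReal_ne_zero.2 ha.ne')]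
  exact rank_testAnnihilator_of_decaysOn_one isOpen_Ioi nonempty_Ioi ordConnected_Ioi
    (decaysOn_Ioi h0) (growsOn_Ioi h1) (growsOn_Ioi h2)

theorem rank_testAnnihilator_airy_sub_one_Iio :
    Module.rank ℂ (testAnnihilator (Iio 0) (airyTest (Iio 0) a b - (1 : ℂ) • 1)) = 2 := by
  obtain ⟨r, μ₁, μ₂, h0, h1, h2, h3, h4, h5⟩ := exists_roots_airy ha b
  have h := airyTest_sub_smul_one_eq (Ω := Iio 0) (a := a) (b := b) (s := 1)
    (l₁ := μ₁) (l₂ := μ₂) (l₃ := r) (by linear_combination h3) (by linear_combination h4)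
    (by push_cast; linear_combination h5)
  rw [Complex.ofReal_one] at h
  rw [h, testAnnihilator_smul (Complex.ofReal_ne_zero.2 ha.ne')]
  exact rank_testAnnihilator_of_decaysOn_two isOpen_Iio nonempty_Iio ordConnected_Iio
    (decaysOn_Iio h1) (decaysOn_Iio h2) (growsOn_Iio h0)

theorem rank_testAnnihilator_airy_add_one_Ioi :
    Module.rank ℂ (testAnnihilator (Ioi 0) (airyTest (Ioi 0) a b - (-1 : ℂ) • 1)) = 2 := by
  obtain ⟨r, μ₁, μ₂, h0, h1, h2, h3, h4, h5⟩ := exists_roots_airy ha b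
  have h := airyTest_sub_smul_one_eq (Ω := Ioi 0) (a := a) (b := b) (s := -1)
    (l₁ := -μ₁) (l₂ := -μ₂) (l₃ := -r) (by linear_combination -h3) (by linear_combination h4)
    (by push_cast; linear_combination -h5)
  rw [Complex.ofReal_neg, Complex.ofReal_one] at h
  rw [h, testAnnihilator_smul (Complex.ofReal_ne_zero.2 ha.ne')]
  exact rank_testAnnihilator_of_decaysOn_two isOpen_Ioi nonempty_Ioi ordConnected_Ioi
    (decaysOn_Ioi (by simpa using h1)) (decaysOn_Ioi (by simpa using h2))
    (growsOn_Ioi (by simpa using h0))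

theorem rank_testAnnihilator_airy_add_one_Iio :
    Module.rank ℂ (testAnnihilator (Iio 0) (airyTest (Iio 0) a b - (-1 : ℂ) • 1)) = 1 := by
  obtain ⟨r, μ₁, μ₂, h0, h1, h2, h3, h4, h5⟩ := exists_roots_airy ha b
  have h := airyTest_sub_smul_one_eq (Ω := Iio 0) (a := a) (b := b) (s := -1)
    (l₁ := -r) (l₂ := -μ₁) (l₃ := -μ₂) (by linear_combination -h3) (by linear_combination h4)
    (by push_cast; linear_combination -h5)
  rw [Complex.ofReal_neg, Complex.ofReal_one] at h
  rw [h, testAnnihilator_smul (Complex.ofReal_ne_zero.2 ha.ne')]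
  exact rank_testAnnihilator_of_decaysOn_one isOpen_Iio nonempty_Iio ordConnected_Iio
    (decaysOn_Iio (by simpa using h0)) (growsOn_Iio (by simpa using h1))
    (growsOn_Iio (by simpa using h2))

end AiryAnnihilator

end StarGraph

namespace StarGraph

/-! ### Decoupling of the edges -/

section StarGraph

variable {Em Ep : Type u}

theorem toL2G_apply (φ : TestG Em Ep) (e : Em ⊕ Ep) :
    (toL2G Em Ep φ : ∀ _, _) e = testToL2 (halfLine e) (φ e) := rfl

theorem A₀_apply (α β : Em ⊕ Ep → ℝ) (φ : TestG Em Ep)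
    (x : (A₀ α β).domain) (hx : (x : L2G Em Ep) = toL2G Em Ep φ) :
    A₀ α β x = toL2G Em Ep (airyG α β φ) := by
  have : (LinearEquiv.ofInjective (toL2G Em Ep) toL2G_injective).symm x = φ :=
    (LinearEquiv.symm_apply_eq _).2 (Subtype.ext hx)
  exact congrArg (toL2G Em Ep ∘ₗ airyG α β) this

theorem isSkewSymmetricOp_A₀ (α β : Em ⊕ Ep → ℝ) : IsSkewSymmetricOp (A₀ α β) := by
  rintro x y
  obtain ⟨φ, hφ⟩ := x.2
  obtain ⟨ψ, hψ⟩ := y.2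
  rw [A₀_apply α β φ x hφ.symm, A₀_apply α β ψ y hψ.symm, ← hφ, ← hψ, lp.inner_eq_tsum,
    lp.inner_eq_tsum, ← tsum_neg]
  exact tsum_congr fun e => inner_airyTest (α e) (β e) (φ e) (ψ e)

theorem isSymmetricOp_I_smul {H : Type u} [NormedAddCommGroup H] [InnerProductSpace ℂ H]
    {A : H →ₗ.[ℂ] H} (hA : IsSkewSymmetricOp A) : IsSymmetricOp (Complex.I • A) := by
  intro x y
  rw [LinearPMap.smul_apply, LinearPMap.smul_apply, inner_smul_left, inner_smul_right, hA x y]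
  simp

/-- The orthogonal complement of an edgewise range is computed edge by edge. -/
theorem mem_orthogonal_range_toL2G_iff (q : ∀ e : Em ⊕ Ep, Module.End ℂ (TestFun (halfLine e)))
    (u : L2G Em Ep) :
    u ∈ (LinearMap.range (toL2G Em Ep ∘ₗ DirectSum.lmap q))ᗮ ↔
      ∀ e, u e ∈ testAnnihilator (halfLine e) (q e) := by
  classical
  rw [Submodule.mem_orthogonal']
  constructor
  · intro h e
    rw [mem_testAnnihilator]
    intro φ
    -- Testing with a family supported on the single edge `e` isolates the component `u e`.
    have h1 := h _ ⟨DirectSum.lof ℂ _ (fun e => TestFun (halfLine e)) e φ, rfl⟩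
    rw [LinearMap.comp_apply, DirectSum.lmap_lof, lp.inner_eq_tsum, tsum_eq_single e] at h1
    · rwa [toL2G_apply, DirectSum.lof_apply] at h1
    · intro e' he
      rw [toL2G_apply, DirectSum.lof_eq_of, DirectSum.of_eq_of_ne _ _ _ he, map_zero,
        inner_zero_right]
  · rintro h _ ⟨φ, rfl⟩
    rw [lp.inner_eq_tsum]
    refine (tsum_congr fun e => ?_).trans tsum_zero
    exact mem_testAnnihilator.1 (h e) (φ e)

theorem dense_range_toL2G :
    Dense ((LinearMap.range (toL2G Em Ep) : Submodule ℂ (L2G Em Ep)) : Set (L2G Em Ep)) := by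
  rw [Submodule.dense_iff_topologicalClosure_eq_top, Submodule.topologicalClosure_eq_top_iff,
    Submodule.eq_bot_iff]
  intro u hu
  have h := mem_orthogonal_range_toL2G_iff (fun _ => 1) u
  rw [show DirectSum.lmap (fun e : Em ⊕ Ep => (1 : Module.End ℂ (TestFun (halfLine e)))) =
    LinearMap.id from DirectSum.lmap_id, LinearMap.comp_id] at h
  refine lp.ext (funext fun e => ?_)
  have := h.1 hu e
  rwa [testAnnihilator_one (isOpen_halfLine e), Submodule.mem_bot] at this

theorem mem_defectSpace_A₀_iff (α β : Em ⊕ Ep → ℝ) (c : ℂ) (u : L2G Em Ep) :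
    u ∈ defectSpace (A₀ α β) c ↔
      ∀ e, u e ∈ testAnnihilator (halfLine e) (airyTest (halfLine e) (α e) (β e) - c • 1) := by
  rw [← mem_orthogonal_range_toL2G_iff, defectSpace]
  have key : ∀ φ, (toL2G Em Ep) (DirectSum.lmap
      (fun e => (airyTest (halfLine e) (α e) (β e) - c • 1 : Module.End ℂ _)) φ) =
      toL2G Em Ep (airyG α β φ) - c • toL2G Em Ep φ := by
    intro φ
    rw [← map_smul, ← map_sub]
    rfl
  have : LinearMap.range ((A₀ α β).toFun - c • (A₀ α β).domain.subtype) =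
      LinearMap.range (toL2G Em Ep ∘ₗ DirectSum.lmap
        fun e => (airyTest (halfLine e) (α e) (β e) - c • 1 : Module.End ℂ _)) := by
    ext v
    constructor
    · rintro ⟨x, rfl⟩
      obtain ⟨φ, hφ⟩ := x.2
      refine ⟨φ, (key φ).trans ?_⟩
      rw [← A₀_apply α β φ x hφ.symm, hφ]
      rfl
    · rintro ⟨φ, rfl⟩
      refine ⟨⟨toL2G Em Ep φ, φ, rfl⟩, Eq.trans ?_ (key φ).symm⟩
      rw [← A₀_apply α β φ ⟨toL2G Em Ep φ, φ, rfl⟩ rfl]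
      rfl
  rw [this]

end StarGraph

/-! ### Hilbert bases of edgewise subspaces -/

section HilbertSum

/-- Orthonormal bases of subspaces `N e` of the summands form a Hilbert basis of the space of
families in the Hilbert sum with components in the `N e`. -/
theorem exists_hilbertBasis_of_forall_mem_iff {ι : Type*} {G : ι → Type*}
    [∀ e, NormedAddCommGroup (G e)] [∀ e, InnerProductSpace ℂ (G e)]
    {κ : ι → Type*} [∀ e, Fintype (κ e)] (N : ∀ e, Submodule ℂ (G e))
    (b : ∀ e, OrthonormalBasis (κ e) ℂ (N e)) (D : Submodule ℂ (lp G 2)) [CompleteSpace D]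
    (hD : ∀ u, u ∈ D ↔ ∀ e, u e ∈ N e) : Nonempty (HilbertBasis (Σ e, κ e) ℂ D) := by
  classical
  have hmem : ∀ e (x : N e), lp.single 2 e (x : G e) ∈ D := by
    intro e x
    rw [hD]
    intro e'
    rcases eq_or_ne e' e with rfl | h
    · rw [lp.single_apply_self]
      exact x.2
    · rw [lp.single_apply_ne _ _ _ h]
      exact (N e').zero_mem
  let v : (Σ e, κ e) → D := fun p => ⟨lp.single 2 p.1 (b p.1 p.2 : G p.1), hmem _ _⟩
  have hv : Orthonormal ℂ v := by
    rw [orthonormal_iff_ite]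
    rintro ⟨e, i⟩ ⟨e', j⟩
    change inner ℂ (lp.single 2 e (b e i : G e)) (lp.single 2 e' (b e' j : G e')) = _
    rw [lp.inner_single_left]
    rcases eq_or_ne e e' with rfl | h
    · rw [lp.single_apply_self, ← Submodule.coe_inner, orthonormal_iff_ite.1 (b e).orthonormal]
      simp
    · rw [lp.single_apply_ne _ _ _ h, inner_zero_right, if_neg]
      exact fun h' => h (congrArg Sigma.fst h')
  refine ⟨HilbertBasis.mkOfOrthogonalEqBot hv ?_⟩
  rw [Submodule.eq_bot_iff]
  rintro ⟨u, hu⟩ huv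
  refine Subtype.ext (lp.ext (funext fun e => ?_))
  have h : (⟨u e, (hD u).1 hu e⟩ : N e) = 0 := by
    refine (b e).repr.injective (PiLp.ext fun i => ?_)
    rw [OrthonormalBasis.repr_apply_apply, map_zero]
    have h1 := Submodule.inner_right_of_mem_orthogonal
      (Submodule.subset_span (mem_range_self (f := v) ⟨e, i⟩)) huv
    change inner ℂ (lp.single 2 e (b e i : G e)) u = 0 at h1
    rw [lp.inner_single_left] at h1
    simpa using h1
  exact congrArg Subtype.val h

end HilbertSum

/-! ### Defect indices and cardinal arithmetic -/

section DefectIndices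

variable {Em Ep : Type u}

theorem mk_sigma_sumElim (m n : ℕ) :
    #(Σ e : Em ⊕ Ep, Fin (Sum.elim (fun _ => m) (fun _ => n) e)) = m * #Em + n * #Ep := by
  rw [Cardinal.mk_congr (Equiv.sumSigmaDistrib _)]
  change #((Σ _ : Em, Fin m) ⊕ (Σ _ : Ep, Fin n)) = _
  rw [Cardinal.mk_sum, Cardinal.mk_congr (Equiv.sigmaEquivProd Em (Fin m)),
    Cardinal.mk_congr (Equiv.sigmaEquivProd Ep (Fin n))]
  simp [mul_comm]

theorem exists_orthonormalBasis_of_rank_eq {E : Type*} [NormedAddCommGroup E]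
    [InnerProductSpace ℂ E] {n : ℕ} (h : Module.rank ℂ E = n) :
    Nonempty (OrthonormalBasis (Fin n) ℂ E) := by
  have hfin : FiniteDimensional ℂ E :=
    Module.rank_lt_aleph0_iff.1 (h ▸ Cardinal.natCast_lt_aleph0)
  exact ⟨(stdOrthonormalBasis ℂ E).reindex (finCongr (Module.finrank_eq_of_rank_eq h))⟩

theorem hilbertDim_defectSpace_A₀ [Countable Em] [Countable Ep] (α β : Em ⊕ Ep → ℝ) (c : ℂ)
    (m n : ℕ)
    (hm : ∀ e : Em, Module.rank ℂ (testAnnihilator (Iio 0)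
      (airyTest (Iio 0) (α (.inl e)) (β (.inl e)) - c • 1)) = m)
    (hn : ∀ e : Ep, Module.rank ℂ (testAnnihilator (Ioi 0)
      (airyTest (Ioi 0) (α (.inr e)) (β (.inr e)) - c • 1)) = n) :
    hilbertDim (defectSpace (A₀ α β) c) = m * #Em + n * #Ep := by
  have hr : ∀ e : Em ⊕ Ep, Module.rank ℂ (testAnnihilator (halfLine e)
      (airyTest (halfLine e) (α e) (β e) - c • 1)) =
        ((Sum.elim (fun _ => m) (fun _ => n) e : ℕ) : Cardinal) := by
    rintro (e | e)
    · exact hm e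
    · exact hn e
  have hc : CompleteSpace (defectSpace (A₀ α β) c) :=
    inferInstanceAs (CompleteSpace ((_ : Submodule ℂ (L2G Em Ep))ᗮ : Submodule ℂ (L2G Em Ep)))
  obtain ⟨b⟩ := exists_hilbertBasis_of_forall_mem_iff _
    (fun e => (exists_orthonormalBasis_of_rank_eq (hr e)).some) _ (mem_defectSpace_A₀_iff α β c)
  rw [hilbertDim_eq_mk b, mk_sigma_sumElim]

/-- Finite cardinals cancel; if both sets are infinite, every term is `ℵ₀`. If exactly one is
infinite, the left equality holds and the right one fails, whence the hypothesis. -/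
theorem two_mul_add_eq_add_two_mul_iff [Countable Em] [Countable Ep]
    (h : Finite Em ↔ Finite Ep) : 2 * #Em + #Ep = #Em + 2 * #Ep ↔ #Ep = #Em := by
  rcases finite_or_infinite Em with hfin | hinf
  · have hfin' := h.1 hfin
    rw [← Nat.cast_card (α := Em), ← Nat.cast_card (α := Ep)]
    norm_cast
    omega
  · have hinf' : Infinite Ep := not_finite_iff_infinite.1 fun h' =>
      not_finite_iff_infinite.2 hinf (h.2 h')
    simp [Cardinal.mk_eq_aleph0]

end DefectIndices

end StarGraph

theorem proposition3p1 {Em Ep : Type u} [Countable Em] [Countable Ep]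
    (α β : Em ⊕ Ep → ℝ) (hα : ∀ e, 0 < α e) :
    Dense ((Complex.I • StarGraph.A₀ α β).domain : Set (StarGraph.L2G Em Ep)) ∧
    StarGraph.IsSymmetricOp (Complex.I • StarGraph.A₀ α β) ∧
    StarGraph.defectIndices (Complex.I • StarGraph.A₀ α β) =
      (2 * #Em + #Ep, #Em + 2 * #Ep) ∧
    ((∃ B : StarGraph.L2G Em Ep →ₗ.[ℂ] StarGraph.L2G Em Ep,
        StarGraph.A₀ α β ≤ B ∧ StarGraph.IsSkewSelfAdjoint B) ↔
      2 * #Em + #Ep = #Em + 2 * #Ep) ∧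
    ((Finite Em ↔ Finite Ep) →
      ((∃ B : StarGraph.L2G Em Ep →ₗ.[ℂ] StarGraph.L2G Em Ep,
          StarGraph.A₀ α β ≤ B ∧ StarGraph.IsSkewSelfAdjoint B) ↔
        #Ep = #Em)) := by
  have hdense : Dense ((StarGraph.A₀ α β).domain : Set (StarGraph.L2G Em Ep)) :=
    StarGraph.dense_range_toL2G
  have hskew := StarGraph.isSkewSymmetricOp_A₀ α β
  have h1 := StarGraph.hilbertDim_defectSpace_A₀ α β 1 2 1
    (fun e => StarGraph.rank_testAnnihilator_airy_sub_one_Iio (hα _) _)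
    (fun e => by simpa using StarGraph.rank_testAnnihilator_airy_sub_one_Ioi (hα _) _)
  have h2 := StarGraph.hilbertDim_defectSpace_A₀ α β (-1) 1 2
    (fun e => by simpa using StarGraph.rank_testAnnihilator_airy_add_one_Iio (hα _) _)
    (fun e => StarGraph.rank_testAnnihilator_airy_add_one_Ioi (hα _) _)
  rw [Nat.cast_one, Nat.cast_ofNat, one_mul] at h1 h2
  have hext := StarGraph.exists_isSkewSelfAdjoint_iff_hilbertDim_eq hdense hskew
  rw [h1, h2] at hext
  refine ⟨hdense, StarGraph.isSymmetricOp_I_smul hskew, ?_, hext, fun h =>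
    hext.trans (StarGraph.two_mul_add_eq_add_two_mul_iff h)⟩
  rw [StarGraph.defectIndices, ← h1, ← h2]
  have e1 := StarGraph.defectSpace_I_smul (StarGraph.A₀ α β) 1
  have e2 := StarGraph.defectSpace_I_smul (StarGraph.A₀ α β) (-1)
  rw [one_mul] at e1
  rw [neg_one_mul] at e2
  rw [e1, e2]
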